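/- Let $R$ be an associative ring with unit and let $\mathrm{Mod}\text{-}R$ be the category of all $R$-modules. For a module $M$, let $\mathrm{Prod}(M)$ be the class of all modules isomorphic to a direct summand of a direct product $M^J$ of copies of $M$ ($J$ an arbitrary set), let $\mathrm{Cogen}(M)$ be the class of all modules isomorphic to a submodule of a module in $\mathrm{Prod}(M)$, and let $\mathrm{Copres}(M)$ be the class of all modules $X$ that admit an exact sequence $0\to X\to M_0\to M_1$ with $M_0,M_1\in\mathrm{Prod}(M)$. A module $T$ is called quasicotilting if $\mathrm{Cogen}(T)=\mathrm{Copres}(T)$, the functor $\mathrm{Hom}_R(-,T)$ preserves exactness of every short exact sequence with all terms in $\mathrm{Cogen}(T)$, and $T$ is $\mathrm{Ext}$-injective in $\mathrm{Cogen}(T)$, i.e. $\mathrm{Ext}^1_R(X,T)=0$ for all $X\in\mathrm{Cogen}(T)$. A module $C$ is called cosilting if there is an exact sequence $0\to C\to Q_0\xrightarrow{\ \zeta\ }Q_1$ with $Q_0,Q_1$ injective such that $\mathrm{Cogen}(C)$ equals the class $\mathscr B_\zeta$ of all modules $M$ for which $\mathrm{Hom}_R(M,\zeta)\colon \mathrm{Hom}_R(M,Q_0)\to\mathrm{Hom}_R(M,Q_1)$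 is surjective. Let $\mathscr U$ be an additive full subcategory of $\mathrm{Mod}\text{-}R$, i.e. one closed under finite direct sums and direct summands, and let $\mathrm{Sub}\,\mathscr U$ be the class of all modules isomorphic to a submodule of a finite direct sum of modules in $\mathscr U$. Then $\mathscr U$ is called a support $\tau^-$-tilting subcategory if 1. $\mathrm{Ext}^1_R(X,U)=0$ for all $X\in\mathrm{Sub}\,\mathscr U$ and $U\in\mathscr U$; 2. for every injective module $I$ there is an exact sequence $0\to U^0\to U^1\xrightarrow{\ g\ } I$ with $U^0,U^1\in\mathscr U$ such that $g$ is a right $\mathscr U$-approximation of $I$, i.e. every homomorphism $U\to I$ with $U\in\mathscr U$ factors through $g$; 3. $\mathscr U$ is covariantly finite: every module $M$ has a left $\mathscr U$-approximation, i.e. a homomorphism $M\to U$ with $U\in\mathscr U$ through which every homomorphism from $M$ to a module in $\mathscr U$ factors. Theorem. (a) If $T$ is a quasicotilting $R$-module, then $\mathrm{Prod}(T)$ is a support $\tau^-$-tilting subcategory of $\mathrm{Mod}\text{-}R$. (b) If $C$ is a cosilting $R$-module, then $\mathrm{Prod}(C)$ is a support $\tau^-$-tilting subcategory of $\mathrm{Mod}\text{-}R$.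 -/

import Mathlib

open CategoryTheory CategoryTheory.Limits

universe w v u

namespace TauTilting

section Abelian

variable {A : Type u} [Category.{v} A]

/-- `φ : X ⟶ M` is a right `U`-approximation of `M`: the object `X` lies in `U` and every morphism
from an object of `U` to `M` factors through `φ`. -/
structure IsRightApproximation (U : ObjectProperty A) {X M : A} (φ : X ⟶ M) : Prop where
  mem : U X
  factors : ∀ (X' : A), U X' → ∀ g : X' ⟶ M, ∃ h : X' ⟶ X, h ≫ φ = g

/-- `φ : M ⟶ X` is a left `U`-approximation of `M`: the object `X` lies in `U` and every morphism
from `M` to an object of `U` factors through `φ`. -/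
structure IsLeftApproximation (U : ObjectProperty A) {M X : A} (φ : M ⟶ X) : Prop where
  mem : U X
  factors : ∀ (X' : A), U X' → ∀ g : M ⟶ X', ∃ h : X ⟶ X', φ ≫ h = g

/-- `U` is covariantly finite: every object has a left `U`-approximation. -/
def IsCovariantlyFinite (U : ObjectProperty A) : Prop :=
  ∀ M : A, ∃ (X : A) (φ : M ⟶ X), IsLeftApproximation U φ

variable [Abelian A]

/-- `U` is an additive full subcategory: it is closed under finite direct sums (including the empty
one) and under direct summands, hence under isomorphisms. -/
structure IsAdditivelyClosed (U : ObjectProperty A) : Prop where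
  finiteSums : U.IsClosedUnderFiniteProducts
  summands : U.IsStableUnderRetracts

/-- `Sub U`: all subobjects of finite direct sums (that is, finite products) of objects of `U`. -/
def SubClass (U : ObjectProperty A) : ObjectProperty A := fun X =>
  ∃ (n : ℕ) (F : Fin n → A) (i : X ⟶ ∏ᶜ F), (∀ j, U (F j)) ∧ Mono i

/-- Exactness of `0 ⟶ X ⟶ Y ⟶ Z`, with maps `f` and `g`. -/
def IsLeftExactSequence {X Y Z : A} (f : X ⟶ Y) (g : Y ⟶ Z) : Prop :=
  Mono f ∧ ∃ zero : f ≫ g = 0, (ShortComplex.mk f g zero).Exact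

/-- Weak support `τ⁻`-tilting subcategories of an abelian category (with enough injectives). -/
structure IsWeakSupportTauMinusTilting [HasExt.{w} A] (U : ObjectProperty A) : Prop where
  additive : IsAdditivelyClosed U
  /-- `Ext¹(Sub U, U) = 0`. -/
  ext_eq_zero : ∀ X Y : A, SubClass U X → U Y → ∀ e : Abelian.Ext.{w} X Y 1, e = 0
  /-- Every injective object `I` admits an exact sequence `0 ⟶ U₀ ⟶ U₁ ⟶ I` with `U₀, U₁` in `U`
  whose last map is a right `U`-approximation of `I`. -/
  approx : ∀ I : A, Injective I → ∃ (U₀ U₁ : A) (f : U₀ ⟶ U₁) (g : U₁ ⟶ I),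
    U U₀ ∧ U U₁ ∧ IsLeftExactSequence f g ∧ IsRightApproximation U g

/-- Support `τ⁻`-tilting subcategories of an abelian category (with enough injectives). -/
structure IsSupportTauMinusTilting [HasExt.{w} A] (U : ObjectProperty A) : Prop
    extends IsWeakSupportTauMinusTilting.{w} U where
  covariantlyFinite : IsCovariantlyFinite U

end Abelian

section Modules

variable {R : Type u} [Ring R]

/-- `Prod T`: the modules isomorphic to a direct summand of a direct product `T ^ J` of copies
of `T`. -/
def ProdClass (T : ModuleCat.{u} R) : ObjectProperty (ModuleCat.{u} R) := fun X =>
  ∃ (J : Type u) (Y : ModuleCat.{u} R), Nonempty ((X × Y) ≃ₗ[R] (J → T))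

/-- `Cogen T`: the modules isomorphic to a submodule of a module in `Prod T`. -/
def Cogen (T : ModuleCat.{u} R) : ObjectProperty (ModuleCat.{u} R) := fun X =>
  ∃ (M : ModuleCat.{u} R) (i : X ⟶ M), ProdClass T M ∧ Mono i

/-- `Copres T`: the modules `X` with an exact sequence `0 ⟶ X ⟶ M₀ ⟶ M₁` where `M₀, M₁` are in
`Prod T`. -/
def Copres (T : ModuleCat.{u} R) : ObjectProperty (ModuleCat.{u} R) := fun X =>
  ∃ (M₀ M₁ : ModuleCat.{u} R) (i : X ⟶ M₀) (d : M₀ ⟶ M₁),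
    ProdClass T M₀ ∧ ProdClass T M₁ ∧ IsLeftExactSequence i d

/-- Quasicotilting modules. -/
structure IsQuasicotilting (T : ModuleCat.{u} R) : Prop where
  cogen_eq_copres : Cogen T = Copres T
  /-- `Hom(-, T)` sends each short exact sequence in `Cogen T` to a short exact sequence. -/
  hom_exact : ∀ S : ShortComplex (ModuleCat.{u} R), S.ShortExact →
    Cogen T S.X₁ → Cogen T S.X₂ → Cogen T S.X₃ →
      Function.Injective (fun h : S.X₃ ⟶ T => S.g ≫ h) ∧
      Function.Exact (fun h : S.X₃ ⟶ T => S.g ≫ h) (fun h : S.X₂ ⟶ T => S.f ≫ h) ∧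
      Function.Surjective (fun h : S.X₂ ⟶ T => S.f ≫ h)
  /-- `T` is Ext-injective in `Cogen T`. -/
  ext_injective : Cogen T T ∧
    ∀ X : ModuleCat.{u} R, Cogen T X → ∀ e : Abelian.Ext.{u} X T 1, e = 0

/-- The class `B_ζ` of all modules `M` such that `Hom(M, ζ)` is surjective. -/
def classB {Q₀ Q₁ : ModuleCat.{u} R} (ζ : Q₀ ⟶ Q₁) : ObjectProperty (ModuleCat.{u} R) := fun M =>
  Function.Surjective (fun h : M ⟶ Q₀ => h ≫ ζ)

/-- `ζ : Q₀ ⟶ Q₁` is an injective copresentation of `C`: the modules `Q₀, Q₁` are injective and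
there is an exact sequence `0 ⟶ C ⟶ Q₀ ⟶ Q₁` with last map `ζ`. -/
def IsInjectiveCopresentation (C : ModuleCat.{u} R) {Q₀ Q₁ : ModuleCat.{u} R}
    (ζ : Q₀ ⟶ Q₁) : Prop :=
  Injective Q₀ ∧ Injective Q₁ ∧ ∃ i : C ⟶ Q₀, IsLeftExactSequence i ζ

/-- `C` is a cosilting module with respect to the injective copresentation `ζ`. -/
structure IsCosiltingWith (C : ModuleCat.{u} R) {Q₀ Q₁ : ModuleCat.{u} R}
    (ζ : Q₀ ⟶ Q₁) : Prop where
  copresentation : IsInjectiveCopresentation C ζ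
  cogen_eq : Cogen C = classB ζ

/-- Cosilting modules. -/
def IsCosilting (C : ModuleCat.{u} R) : Prop :=
  ∃ (Q₀ Q₁ : ModuleCat.{u} R) (ζ : Q₀ ⟶ Q₁), IsCosiltingWith C ζ

end Modules

end TauTilting

/-! Both parts reduce to two properties of `T`: maps into `T` extend along inclusions with cokernel
in Cogen(T) (`IsExtInjectiveFor`), and each module in Cogen(T) embeds in a power of `T` with
cokernel in Cogen(T) (`HasClosedEmbeddings`). The first yields the Ext-vanishing; evaluation into a
power is a left approximation of any module.

The main work is to approximate an injective `I`. A map from Cogen(T) to `I` has image in the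
elements killed by ann(T). Cover these by a free R/ann(T)-module `P`, with kernel `K`, and push out
along K → T^Hom(K,T). Maps from `K` to `T` extend to T^Hom(K,T) × P, so the pushout `E` is in
Cogen(T) (`isClosedFor_of_extends`); Ext-injectivity lifts maps to `E`
(`exists_precover_of_isSeparatedBy`). Injectivity of `I` extends E → I to a power of `T`
(`exists_power_precover`). The kernel of such a precover is a summand of a power
(`exists_retraction_ker`). -/

namespace TauTilting

/-! ### Relative injectivity, closures and precovers -/

section LinearAlgebra

variable {R : Type u} [Ring R]

/-- A submodule `N` of `Y` is `T`-closed if `Y ⧸ N` is cogenerated by `T`. -/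
def IsClosedFor (T : Type u) [AddCommGroup T] [Module R T] {Y : Type u} [AddCommGroup Y]
    [Module R Y] (N : Submodule R Y) : Prop :=
  ∀ y, (∀ f : Y →ₗ[R] T, N ≤ LinearMap.ker f → f y = 0) → y ∈ N

/-- The linear maps from `X` to `T` separate the points of `X`. -/
def IsSeparatedBy (R : Type u) [Ring R] (T : Type u) [AddCommGroup T] [Module R T] (X : Type u)
    [AddCommGroup X] [Module R X] : Prop :=
  ∀ x : X, (∀ f : X →ₗ[R] T, f x = 0) → x = 0

/-- `U` is injective with respect to all inclusions of `T`-closed submodules. -/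
def IsExtInjectiveFor (R : Type u) [Ring R] (T : Type u) [AddCommGroup T] [Module R T]
    (U : Type u) [AddCommGroup U] [Module R U] : Prop :=
  ∀ (Y : Type u) [AddCommGroup Y] [Module R Y] (N : Submodule R Y), IsClosedFor T N →
    ∀ f : N →ₗ[R] U, ∃ g : Y →ₗ[R] U, g ∘ₗ N.subtype = f

/-- Every module cogenerated by `T` embeds into a power of `T` with a cokernel cogenerated
by `T`. -/
def HasClosedEmbeddings (R : Type u) [Ring R] (T : Type u) [AddCommGroup T] [Module R T] : Prop :=
  ∀ (X : Type u) [AddCommGroup X] [Module R X], IsSeparatedBy R T X →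
    ∃ (J : Type u) (i : X →ₗ[R] (J → T)), Function.Injective i ∧
      IsClosedFor T (LinearMap.range i)

variable {T : Type u} [AddCommGroup T] [Module R T]
variable {A X Y : Type u} [AddCommGroup A] [Module R A] [AddCommGroup X] [Module R X]
  [AddCommGroup Y] [Module R Y]

lemma exists_comp_eq_of_surjective {p : X →ₗ[R] Y} (hp : Function.Surjective p) {f : X →ₗ[R] A}
    (h : LinearMap.ker p ≤ LinearMap.ker f) : ∃ g : Y →ₗ[R] A, g ∘ₗ p = f := by
  refine ⟨(LinearMap.ker p).liftQ f h ∘ₗ (p.quotKerEquivOfSurjective hp).symm.toLinearMap, ?_⟩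
  ext x
  have : (p.quotKerEquivOfSurjective hp).symm (p x) = Submodule.Quotient.mk x := by
    rw [LinearEquiv.symm_apply_eq]; rfl
  simp [this]

lemma IsSeparatedBy.of_injective (hY : IsSeparatedBy R T Y) (i : X →ₗ[R] Y)
    (hi : Function.Injective i) : IsSeparatedBy R T X := fun _ hx =>
  hi (by rw [map_zero]; exact hY _ fun f => hx (f ∘ₗ i))

lemma isSeparatedBy_power (J : Type u) : IsSeparatedBy R T (J → T) :=
  fun _ hx => funext fun j => hx (LinearMap.proj j)

lemma IsSeparatedBy.prod (hX : IsSeparatedBy R T X) (hY : IsSeparatedBy R T Y) :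
    IsSeparatedBy R T (X × Y) := fun _ hx =>
  Prod.ext (hX _ fun f => hx (f ∘ₗ LinearMap.fst R X Y))
    (hY _ fun f => hx (f ∘ₗ LinearMap.snd R X Y))

/-- The evaluation map from a module into a power of `T`. -/
def evalPower (R : Type u) [Ring R] (T : Type u) [AddCommGroup T] [Module R T] (X : Type u)
    [AddCommGroup X] [Module R X] : X →ₗ[R] ((X →ₗ[R] T) → T) :=
  LinearMap.pi fun f => f

lemma IsSeparatedBy.evalPower_injective (hX : IsSeparatedBy R T X) :
    Function.Injective (evalPower R T X) := by
  rw [injective_iff_map_eq_zero]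
  exact fun x hx => hX x fun f => congrFun hx f

lemma isSeparatedBy_quotient_iff {N : Submodule R Y} :
    IsSeparatedBy R T (Y ⧸ N) ↔ IsClosedFor T N := by
  constructor
  · intro h y hy
    rw [← Submodule.Quotient.mk_eq_zero]
    refine h _ fun f => hy (f ∘ₗ N.mkQ) fun n hn => ?_
    simp [(Submodule.Quotient.mk_eq_zero N).2 hn]
  · intro h x
    obtain ⟨y, rfl⟩ := N.mkQ_surjective x
    intro hy
    exact (Submodule.Quotient.mk_eq_zero N).2 (h y fun f hf => hy (N.liftQ f hf))

lemma isClosedFor_ker (f : X →ₗ[R] Y) (hY : IsSeparatedBy R T Y) :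
    IsClosedFor T (LinearMap.ker f) := fun _ hx =>
  hY _ fun g => hx (g ∘ₗ f) (LinearMap.ker_le_ker_comp f g)

lemma IsExtInjectiveFor.exists_extension {U : Type u} [AddCommGroup U] [Module R U]
    (hU : IsExtInjectiveFor R T U) {i : X →ₗ[R] Y} (hi : Function.Injective i)
    (hc : IsClosedFor T (LinearMap.range i)) (f : X →ₗ[R] U) :
    ∃ g : Y →ₗ[R] U, g ∘ₗ i = f := by
  obtain ⟨g, hg⟩ := hU Y _ hc (f ∘ₗ (LinearEquiv.ofInjective i hi).symm.toLinearMap)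
  refine ⟨g, ?_⟩
  ext x
  simpa using LinearMap.congr_fun hg (LinearEquiv.ofInjective i hi x)

lemma IsExtInjectiveFor.power {U : Type u} [AddCommGroup U] [Module R U]
    (hU : IsExtInjectiveFor R T U) (J : Type u) : IsExtInjectiveFor R T (J → U) := by
  intro Y _ _ N hN f
  choose g hg using fun j => hU Y N hN (LinearMap.proj j ∘ₗ f)
  exact ⟨LinearMap.pi g, LinearMap.ext fun x => funext fun j => LinearMap.congr_fun (hg j) x⟩

lemma IsExtInjectiveFor.retract {U V : Type u} [AddCommGroup U] [Module R U] [AddCommGroup V]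
    [Module R V] (hU : IsExtInjectiveFor R T U) (s : V →ₗ[R] U) (r : U →ₗ[R] V)
    (hrs : r ∘ₗ s = LinearMap.id) : IsExtInjectiveFor R T V := by
  intro Y _ _ N hN f
  obtain ⟨g, hg⟩ := hU Y N hN (s ∘ₗ f)
  exact ⟨r ∘ₗ g, by rw [LinearMap.comp_assoc, hg, ← LinearMap.comp_assoc, hrs, LinearMap.id_comp]⟩

/-- The smallest `T`-closed submodule containing `N`. -/
def closureFor (T : Type u) [AddCommGroup T] [Module R T] (N : Submodule R Y) : Submodule R Y :=
  ⨅ (f : Y →ₗ[R] T) (_ : N ≤ LinearMap.ker f), LinearMap.ker f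

lemma mem_closureFor {N : Submodule R Y} {y : Y} :
    y ∈ closureFor T N ↔ ∀ f : Y →ₗ[R] T, N ≤ LinearMap.ker f → f y = 0 := by
  simp [closureFor, Submodule.mem_iInf]

lemma le_closureFor (N : Submodule R Y) : N ≤ closureFor T N := fun _ hy =>
  mem_closureFor.2 fun _ hf => hf hy

lemma isClosedFor_closureFor (N : Submodule R Y) : IsClosedFor T (closureFor T N) := fun _ hy =>
  mem_closureFor.2 fun f hf => hy f fun _ hz => mem_closureFor.1 hz f hf

/-- The map extends to `Y`, and the extension kills `N`, hence by definition also its closure. -/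
lemma IsExtInjectiveFor.eq_zero_of_closureFor (hT : IsExtInjectiveFor R T T) {N : Submodule R Y}
    (h : closureFor T N →ₗ[R] T) (h0 : ∀ x : closureFor T N, (x : Y) ∈ N → h x = 0) : h = 0 := by
  obtain ⟨g, rfl⟩ := hT Y _ (isClosedFor_closureFor N) h
  ext x
  exact mem_closureFor.1 x.2 g fun n hn => h0 ⟨n, le_closureFor N hn⟩ hn

/-- A submodule `N` of a module cogenerated by `T` such that all homomorphisms from `N` to `T`
extend is `T`-closed. -/
theorem isClosedFor_of_extends (hT : IsExtInjectiveFor R T T) (hC : HasClosedEmbeddings R T)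
    (hY : IsSeparatedBy R T Y) (N : Submodule R Y)
    (hN : ∀ f : N →ₗ[R] T, ∃ g : Y →ₗ[R] T, g ∘ₗ N.subtype = f) : IsClosedFor T N := by
  obtain ⟨J, i, hi, hic⟩ := hC N (hY.of_injective N.subtype N.injective_subtype)
  choose g hg using fun j => hN (LinearMap.proj j ∘ₗ i)
  let G : Y →ₗ[R] (J → T) := LinearMap.pi g
  have hG (n : N) : G n = i n := funext fun j => LinearMap.congr_fun (hg j) n
  have hmem (y : closureFor T N) : G y ∈ LinearMap.range i := by
    refine hic _ fun φ hφ => mem_closureFor.1 y.2 (φ ∘ₗ G) fun n hn => ?_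
    have := hφ ⟨⟨n, hn⟩, rfl⟩
    simpa [hG ⟨n, hn⟩] using this
  let r : closureFor T N →ₗ[R] N := (LinearEquiv.ofInjective i hi).symm.toLinearMap ∘ₗ
    (G ∘ₗ (closureFor T N).subtype).codRestrict _ hmem
  have hr (y : closureFor T N) (hy : (y : Y) ∈ N) : (r y : Y) = y := by
    have : r y = ⟨y, hy⟩ := by
      simp only [r, LinearMap.comp_apply, LinearEquiv.coe_coe, LinearEquiv.symm_apply_eq]
      exact Subtype.ext (hG ⟨y, hy⟩)
    rw [this]
  intro y hy
  have hy' : y ∈ closureFor T N := mem_closureFor.2 hy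
  -- Identity minus retraction kills `N`, so every map to `T` composed with it is zero on the
  -- closure.
  have key : y - r ⟨y, hy'⟩ = 0 := hY _ fun f => by
    have := hT.eq_zero_of_closureFor (N := N)
      (f ∘ₗ ((closureFor T N).subtype - N.subtype ∘ₗ r)) fun x hx => by simp [hr x hx]
    simpa using LinearMap.congr_fun this ⟨y, hy'⟩
  rw [sub_eq_zero.1 key]
  exact (r ⟨y, hy'⟩).2

/-- The universal extension by a power of `T` is a precover by modules cogenerated by `T`. -/
theorem exists_precover_of_isSeparatedBy (hT : IsExtInjectiveFor R T T)
    (hC : HasClosedEmbeddings R T) {P M : Type u} [AddCommGroup P] [Module R P] [AddCommGroup M]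
    [Module R M] (hP : IsSeparatedBy R T P) (π : P →ₗ[R] M) :
    ∃ (E : Type u) (_ : AddCommGroup E) (_ : Module R E) (ε : E →ₗ[R] M), IsSeparatedBy R T E ∧
      ∀ (Y : Type u) [AddCommGroup Y] [Module R Y], IsSeparatedBy R T Y → ∀ φ : Y →ₗ[R] M,
        LinearMap.range φ ≤ LinearMap.range π → ∃ h : Y →ₗ[R] E, ε ∘ₗ h = φ := by
  let K := LinearMap.ker π
  let ι : K →ₗ[R] ((K →ₗ[R] T) → T) × P := (evalPower R T K).prod K.subtype
  have hι : Function.Injective ι := fun a b h => Subtype.ext (congrArg Prod.snd h)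
  have hclosed : IsClosedFor T (LinearMap.range ι) := by
    refine isClosedFor_of_extends hT hC ((isSeparatedBy_power _).prod hP) _ fun f => ?_
    -- The power is indexed by all maps K → T, so a coordinate projection extends the given one.
    refine ⟨LinearMap.proj (f ∘ₗ ι.rangeRestrict) ∘ₗ LinearMap.fst R _ _, ?_⟩
    ext ⟨_, k, rfl⟩
    rfl
  have hle : LinearMap.range ι ≤ LinearMap.ker (π ∘ₗ LinearMap.snd R ((K →ₗ[R] T) → T) P) := by
    rintro _ ⟨k, rfl⟩
    exact k.2
  refine ⟨_ ⧸ LinearMap.range ι, inferInstance, inferInstance, (LinearMap.range ι).liftQ _ hle,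
    isSeparatedBy_quotient_iff.2 hclosed, fun Y _ _ hY φ hφ => ?_⟩
  -- The pullback of `φ` and `π`. Its projection to `Y` has kernel identified with a submodule of
  -- `K`, and the evaluation of `K` extends from there to `B`; the resulting map B → E descends to
  -- `Y`.
  let B : Submodule R (Y × P) :=
    LinearMap.ker (φ ∘ₗ LinearMap.fst R Y P - π ∘ₗ LinearMap.snd R Y P)
  have hB (b : B) : φ b.1.1 = π b.1.2 := sub_eq_zero.1 b.2
  let q : B →ₗ[R] Y := LinearMap.fst R Y P ∘ₗ B.subtype
  have hq : Function.Surjective q := fun y => by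
    obtain ⟨p, hp⟩ := hφ ⟨y, rfl⟩
    exact ⟨⟨(y, p), sub_eq_zero.2 hp.symm⟩, rfl⟩
  let c : LinearMap.ker q →ₗ[R] K :=
    (LinearMap.snd R Y P ∘ₗ B.subtype ∘ₗ (LinearMap.ker q).subtype).codRestrict _ fun x => by
      have h1 : x.1.1.1 = 0 := x.2
      have h2 := hB x.1
      rw [h1, map_zero] at h2
      exact h2.symm
  obtain ⟨s, hs⟩ := hT.power (K →ₗ[R] T) B (LinearMap.ker q) (isClosedFor_ker q hY)
    (evalPower R T K ∘ₗ c)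
  obtain ⟨h, hh⟩ := exists_comp_eq_of_surjective hq
    (f := (LinearMap.range ι).mkQ ∘ₗ s.prod (LinearMap.snd R Y P ∘ₗ B.subtype)) (by
      intro b hb
      rw [LinearMap.mem_ker, LinearMap.comp_apply, Submodule.mkQ_apply,
        Submodule.Quotient.mk_eq_zero]
      exact ⟨c ⟨b, hb⟩, Prod.ext (LinearMap.congr_fun hs ⟨b, hb⟩).symm rfl⟩)
  refine ⟨h, LinearMap.ext fun y => ?_⟩
  obtain ⟨b, rfl⟩ := hq y
  have := LinearMap.congr_fun hh b
  simp only [LinearMap.comp_apply] at this ⊢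
  rw [this]
  exact (hB b).symm

/-- Every injective module has a precover by a power of `T`. -/
theorem exists_power_precover (hT : IsExtInjectiveFor R T T) (hC : HasClosedEmbeddings R T)
    (I : Type u) [AddCommGroup I] [Module R I] [Module.Injective R I] :
    ∃ (J : Type u) (γ : (J → T) →ₗ[R] I), ∀ (Y : Type u) [AddCommGroup Y] [Module R Y],
      IsSeparatedBy R T Y → ∀ φ : Y →ₗ[R] I, ∃ h : Y →ₗ[R] (J → T), γ ∘ₗ h = φ := by
  let S : Type u := {x : I // ∀ r : R, (∀ t : T, r • t = 0) → r • x = 0}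
  let π : (S →₀ R) →ₗ[R] I := Finsupp.linearCombination R Subtype.val
  -- The kernel of `ρ` consists of the vectors with coefficients in ann(T), so the quotient is free
  -- over R/ann(T) and embeds in a power of `T`.
  let ρ : (S →₀ R) →ₗ[R] (T × S → T) :=
    LinearMap.pi fun a => LinearMap.toSpanSingleton R T a.1 ∘ₗ Finsupp.lapply a.2
  have hρπ : LinearMap.ker ρ ≤ LinearMap.ker π := by
    intro a ha
    rw [LinearMap.mem_ker, Finsupp.linearCombination_apply]
    exact Finset.sum_eq_zero fun x _ => x.2 _ fun t => congrFun ha (t, x)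
  obtain ⟨E, _, _, ε, hE, hlift⟩ := exists_precover_of_isSeparatedBy hT hC
    ((isSeparatedBy_power _).of_injective ((LinearMap.ker ρ).liftQ ρ le_rfl)
      (LinearMap.ker_eq_bot.1 (Submodule.ker_liftQ_eq_bot _ _ _ le_rfl)))
    ((LinearMap.ker ρ).liftQ π hρπ)
  obtain ⟨γ, hγ⟩ := Module.Injective.out (evalPower R T E) hE.evalPower_injective ε
  refine ⟨_, γ, fun Y _ _ hY φ => ?_⟩
  obtain ⟨h, hh⟩ := hlift Y hY φ (by
    rintro _ ⟨y, rfl⟩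
    have hy : ∀ r : R, (∀ t : T, r • t = 0) → r • φ y = 0 := fun r hr => by
      rw [← map_smul, hY (r • y) fun f => by rw [map_smul, hr], map_zero]
    exact ⟨Submodule.Quotient.mk (Finsupp.single (⟨φ y, hy⟩ : S) 1), by simp [π]⟩)
  exact ⟨evalPower R T E ∘ₗ h, LinearMap.ext fun y =>
    (hγ (h y)).trans (LinearMap.congr_fun hh y)⟩

/-- The kernel of a precover by a power of `T` is a direct summand of a power of `T`. -/
theorem exists_retraction_ker (hT : IsExtInjectiveFor R T T) (hC : HasClosedEmbeddings R T)
    {J I : Type u} [AddCommGroup I] [Module R I] (γ : (J → T) →ₗ[R] I)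
    (hγ : ∀ (Y : Type u) [AddCommGroup Y] [Module R Y], IsSeparatedBy R T Y →
      ∀ φ : Y →ₗ[R] I, ∃ h : Y →ₗ[R] (J → T), γ ∘ₗ h = φ) :
    ∃ (L : Type u) (s : LinearMap.ker γ →ₗ[R] (L → T)) (r : (L → T) →ₗ[R] LinearMap.ker γ),
      r ∘ₗ s = LinearMap.id := by
  obtain ⟨L, i, hi, hic⟩ := hC (LinearMap.ker γ)
    ((isSeparatedBy_power J).of_injective _ (LinearMap.ker γ).injective_subtype)
  obtain ⟨a, ha⟩ := (hT.power J).exists_extension hi hic (LinearMap.ker γ).subtype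
  -- γ ∘ a vanishes on ker γ, so it factors through the cokernel of `i` and lifts along `γ`;
  -- subtracting this lift makes `a` land in ker γ.
  obtain ⟨h, hh⟩ := hγ _ (isSeparatedBy_quotient_iff.2 hic)
    ((LinearMap.range i).liftQ (γ ∘ₗ a) (by
      rintro _ ⟨k, rfl⟩
      have := LinearMap.congr_fun ha k
      simp only [LinearMap.comp_apply] at this
      simp [this]))
  refine ⟨L, i, (a - h ∘ₗ (LinearMap.range i).mkQ).codRestrict _ fun x => ?_, ?_⟩
  · have := LinearMap.congr_fun hh ((LinearMap.range i).mkQ x)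
    simp only [LinearMap.comp_apply, Submodule.mkQ_apply, Submodule.liftQ_apply] at this
    simp [this]
  · refine LinearMap.ext fun k => Subtype.ext ?_
    have h1 : a (i k) = k := LinearMap.congr_fun ha k
    have h2 : (LinearMap.range i).mkQ (i k) = 0 :=
      (Submodule.Quotient.mk_eq_zero _).2 ⟨k, rfl⟩
    change a (i k) - h ((LinearMap.range i).mkQ (i k)) = k
    rw [h1, h2, map_zero, sub_zero]

end LinearAlgebra

/-! ### Passage to the categorical definitions -/

section Translation

variable {R : Type u} [Ring R]

lemma prodClass_iff {T X : ModuleCat.{u} R} : ProdClass T X ↔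
    ∃ (J : Type u) (s : X →ₗ[R] (J → T)) (r : (J → T) →ₗ[R] X), r ∘ₗ s = LinearMap.id := by
  constructor
  · rintro ⟨J, Y, ⟨e⟩⟩
    exact ⟨J, e.toLinearMap ∘ₗ LinearMap.inl R X Y, LinearMap.fst R X Y ∘ₗ e.symm.toLinearMap,
      by ext x; simp⟩
  · rintro ⟨J, s, r, hrs⟩
    have h (x : X) : r (s x) = x := LinearMap.congr_fun hrs x
    refine ⟨J, ModuleCat.of R (LinearMap.ker r), ⟨LinearEquiv.ofLinearMap
      (s.coprod (LinearMap.ker r).subtype)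
      (r.prod ((LinearMap.id - s ∘ₗ r).codRestrict _ fun v => by simp [h])) ?_ ?_⟩⟩
    · ext1 v
      simp
    · refine LinearMap.ext fun ⟨x, k⟩ => Prod.ext ?_ (Subtype.ext ?_)
      · simp [h]
      · simp [h]

lemma prodClass_power (T : ModuleCat.{u} R) (J : Type u) :
    ProdClass T (ModuleCat.of R (J → T)) :=
  prodClass_iff.2 ⟨J, LinearMap.id, LinearMap.id, rfl⟩

lemma cogen_iff {T X : ModuleCat.{u} R} : Cogen T X ↔ IsSeparatedBy R T X := by
  constructor
  · rintro ⟨M, i, hM, hi⟩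
    obtain ⟨J, s, r, hrs⟩ := prodClass_iff.1 hM
    refine (isSeparatedBy_power J).of_injective (s ∘ₗ i.hom) ?_
    exact (Function.LeftInverse.injective (g := r) fun x => LinearMap.congr_fun hrs x).comp
      ((ModuleCat.mono_iff_injective i).1 hi)
  · intro h
    exact ⟨ModuleCat.of R ((X →ₗ[R] T) → T), ModuleCat.ofHom (evalPower R T X),
      prodClass_power T _, (ModuleCat.mono_iff_injective _).2 h.evalPower_injective⟩

lemma ProdClass.isSeparatedBy {T X : ModuleCat.{u} R} (h : ProdClass T X) :
    IsSeparatedBy R T X :=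
  cogen_iff.1 ⟨X, 𝟙 X, h, inferInstance⟩

lemma ProdClass.isExtInjectiveFor {T X : ModuleCat.{u} R} (h : ProdClass T X)
    (hT : IsExtInjectiveFor R T T) : IsExtInjectiveFor R T X := by
  obtain ⟨J, s, r, hrs⟩ := prodClass_iff.1 h
  exact (hT.power J).retract s r hrs

lemma isLeftExactSequence_iff {X Y Z : ModuleCat.{u} R} {f : X ⟶ Y} {g : Y ⟶ Z} :
    IsLeftExactSequence f g ↔
      Function.Injective f.hom ∧ LinearMap.range f.hom = LinearMap.ker g.hom := by
  rw [IsLeftExactSequence, ModuleCat.mono_iff_injective]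
  refine and_congr Iff.rfl ⟨?_, fun h => ?_⟩
  · rintro ⟨_, h⟩
    exact h.moduleCat_range_eq_ker
  · have h0 : f ≫ g = 0 := by
      ext x
      exact h.le ⟨x, rfl⟩
    exact ⟨h0, (ShortComplex.moduleCat_exact_iff_range_eq_ker _).2 h⟩

/-- If `Ext¹(X, T)` vanishes for `X` in `Cogen T`, then maps to `T` extend along inclusions with
cokernel in `Cogen T`. -/
lemma isExtInjectiveFor_of_ext_eq_zero {T : ModuleCat.{u} R}
    (h : ∀ X : ModuleCat.{u} R, Cogen T X → ∀ e : Abelian.Ext.{u} X T 1, e = 0) :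
    IsExtInjectiveFor R T T := by
  intro Y _ _ N hN f
  let S : ShortComplex (ModuleCat.{u} R) := ShortComplex.mk (ModuleCat.ofHom N.subtype)
    (ModuleCat.ofHom N.mkQ) (by ext x; simp)
  have hS : S.ShortExact := ModuleCat.shortComplex_shortExact S
    (LinearMap.exact_subtype_mkQ N) N.injective_subtype N.mkQ_surjective
  obtain ⟨x, hx⟩ := Abelian.Ext.contravariant_sequence_exact₁ hS T
    (Abelian.Ext.mk₀ (ModuleCat.ofHom f : S.X₁ ⟶ T)) (add_zero 1)
    (h _ (cogen_iff.2 (isSeparatedBy_quotient_iff.2 hN)) _)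
  obtain ⟨g, rfl⟩ := (Abelian.Ext.mk₀_bijective _ _).2 x
  rw [Abelian.Ext.mk₀_comp_mk₀] at hx
  exact ⟨g.hom, congrArg ModuleCat.Hom.hom ((Abelian.Ext.mk₀_bijective _ _).1 hx)⟩

/-- Dimension shift: a class comes from a map on the kernel of a projective cover P → X; that map
extends to `P`, so its connecting image is zero. -/
lemma ext_eq_zero_of_isExtInjectiveFor {T X U : ModuleCat.{u} R} (hU : IsExtInjectiveFor R T U)
    (hX : IsSeparatedBy R T X) (e : Abelian.Ext.{u} X U 1) : e = 0 := by
  have hsurj := (ModuleCat.epi_iff_surjective _).1 (Projective.π_epi X)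
  have hS := LinearMap.shortExact_shortComplexKer (f := (Projective.π X).hom) hsurj
  obtain ⟨x, hx⟩ := Abelian.Ext.contravariant_sequence_exact₃ hS U e
    (Abelian.Ext.eq_zero_of_projective (P := Projective.over X) _) (add_zero 1)
  obtain ⟨k, rfl⟩ := (Abelian.Ext.mk₀_bijective _ _).2 x
  obtain ⟨g, hg⟩ := hU _ (LinearMap.ker (Projective.π X).hom) (isClosedFor_ker _ hX) k.hom
  have hk : k = (Projective.π X).hom.shortComplexKer.f ≫ ModuleCat.ofHom g :=
    ModuleCat.hom_ext hg.symm
  rw [← hx, hk, ← Abelian.Ext.mk₀_comp_mk₀, hS.extClass_comp_assoc]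

lemma subClass_prodClass_isSeparatedBy {T X : ModuleCat.{u} R} (h : SubClass (ProdClass T) X) :
    IsSeparatedBy R T X := by
  obtain ⟨n, F, i, hF, hi⟩ := h
  let p : (∏ᶜ F : ModuleCat.{u} R) →ₗ[R] (∀ j, F j) := (ModuleCat.piIsoPi F).hom.hom
  have hp : Function.Injective p :=
    (ModuleCat.mono_iff_injective (ModuleCat.piIsoPi F).hom).1 inferInstance
  have hsep : IsSeparatedBy R T (∀ j, F j) := fun x hx =>
    funext fun j => (hF j).isSeparatedBy _ fun f => hx (f ∘ₗ LinearMap.proj j)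
  exact hsep.of_injective (p ∘ₗ i.hom) (hp.comp ((ModuleCat.mono_iff_injective i).1 hi))

lemma prodClass_isAdditivelyClosed (T : ModuleCat.{u} R) : IsAdditivelyClosed (ProdClass T) := by
  have hretr : (ProdClass T).IsStableUnderRetracts := ⟨fun {X Y} ρ hY => by
    obtain ⟨J, s, r, hrs⟩ := prodClass_iff.1 hY
    refine prodClass_iff.2 ⟨J, s ∘ₗ ρ.i.hom, ρ.r.hom ∘ₗ r, LinearMap.ext fun x => ?_⟩
    have h1 : r (s (ρ.i.hom x)) = ρ.i.hom x := LinearMap.congr_fun hrs _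
    have h2 : ρ.r.hom (ρ.i.hom x) = x :=
      LinearMap.congr_fun (congrArg ModuleCat.Hom.hom ρ.retract) x
    simp only [LinearMap.comp_apply, h1, h2, LinearMap.id_apply]⟩
  refine ⟨⟨fun J _ => ⟨?_⟩⟩, hretr⟩
  rintro X ⟨p⟩
  have hF (j : J) : ProdClass T (p.diag.obj ⟨j⟩) := p.prop_diag_obj ⟨j⟩
  choose L s r hrs using fun j => prodClass_iff.1 (hF j)
  let F : J → ModuleCat.{u} R := fun j => p.diag.obj ⟨j⟩
  let e : X ≅ ModuleCat.of R (∀ j, F j) :=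
    p.isLimit.conePointsIsoOfNatIso (ModuleCat.productConeIsLimit F)
      (Discrete.natIso fun _ => Iso.refl _)
  have : ProdClass T (ModuleCat.of R (∀ j, F j)) := by
    refine prodClass_iff.2 ⟨Σ j, L j, LinearMap.pi fun a => LinearMap.proj a.2 ∘ₗ s a.1 ∘ₗ
      LinearMap.proj a.1, LinearMap.pi fun j => r j ∘ₗ LinearMap.pi fun l =>
      LinearMap.proj (⟨j, l⟩ : Σ j, L j), LinearMap.ext fun x => funext fun j => ?_⟩
    exact LinearMap.congr_fun (hrs j) (x j)
  exact (ProdClass T).prop_of_retract ⟨e.hom, e.inv, e.hom_inv_id⟩ this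

lemma prodClass_isCovariantlyFinite (T : ModuleCat.{u} R) :
    IsCovariantlyFinite (ProdClass T) := fun M => by
  refine ⟨ModuleCat.of R ((M →ₗ[R] T) → T), ModuleCat.ofHom (evalPower R T M),
    prodClass_power T _, fun X hX g => ?_⟩
  obtain ⟨J, s, r, hrs⟩ := prodClass_iff.1 hX
  refine ⟨ModuleCat.ofHom (r ∘ₗ LinearMap.pi fun j =>
    LinearMap.proj (LinearMap.proj j ∘ₗ s ∘ₗ g.hom)), ModuleCat.hom_ext (LinearMap.ext fun x => ?_)⟩
  exact LinearMap.congr_fun hrs (g.hom x)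

/-- `Prod T` is support `τ⁻`-tilting as soon as `T` is Ext-injective in `Cogen T` and every module
in `Cogen T` embeds into a power of `T` with cokernel in `Cogen T`. -/
theorem prodClass_isSupportTauMinusTilting {T : ModuleCat.{u} R} (hT : IsExtInjectiveFor R T T)
    (hC : HasClosedEmbeddings R T) : IsSupportTauMinusTilting.{u} (ProdClass T) where
  additive := prodClass_isAdditivelyClosed T
  ext_eq_zero _ _ hX hU := ext_eq_zero_of_isExtInjectiveFor (hU.isExtInjectiveFor hT)
    (subClass_prodClass_isSeparatedBy hX)
  approx I _ := by
    have : Module.Injective R I := Module.injective_module_of_injective_object R I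
    obtain ⟨J, γ, hγ⟩ := exists_power_precover hT hC I
    refine ⟨ModuleCat.of R (LinearMap.ker γ), ModuleCat.of R (J → T),
      ModuleCat.ofHom (LinearMap.ker γ).subtype, ModuleCat.ofHom γ,
      prodClass_iff.2 (exists_retraction_ker hT hC γ hγ), prodClass_power T J,
      isLeftExactSequence_iff.2 ⟨(LinearMap.ker γ).injective_subtype, Submodule.range_subtype _⟩,
      prodClass_power T J, fun X hX g => ?_⟩
    obtain ⟨h, hh⟩ := hγ X hX.isSeparatedBy g.hom
    exact ⟨ModuleCat.ofHom h, ModuleCat.hom_ext hh⟩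
  covariantlyFinite := prodClass_isCovariantlyFinite T

lemma hasClosedEmbeddings_of_cogen_eq_copres {T : ModuleCat.{u} R} (h : Cogen T = Copres T) :
    HasClosedEmbeddings R T := by
  intro X _ _ hX
  have hX' : Cogen T (ModuleCat.of R X) := cogen_iff.2 hX
  rw [h] at hX'
  obtain ⟨M₀, M₁, i, d, h₀, h₁, hid⟩ := hX'
  obtain ⟨hi, hex⟩ := isLeftExactSequence_iff.1 hid
  obtain ⟨J, Y, ⟨e⟩⟩ := h₀
  have hY : IsSeparatedBy R T Y := (isSeparatedBy_power J).of_injective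
    (e.toLinearMap ∘ₗ LinearMap.inr R M₀ Y) (e.injective.comp LinearMap.inr_injective)
  -- Adding the complement `Y` of `M₀` turns `M₀` into a power; the identity on `Y` keeps `X` as the
  -- kernel of a map to M₁ × Y.
  let j : X →ₗ[R] (J → T) := e.toLinearMap ∘ₗ LinearMap.inl R M₀ Y ∘ₗ i.hom
  have hj : LinearMap.range j = LinearMap.ker (LinearMap.prodMap d.hom
      (LinearMap.id : Y →ₗ[R] Y) ∘ₗ e.symm.toLinearMap) := by
    ext v
    obtain ⟨⟨m, y⟩, rfl⟩ := e.surjective v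
    have hm : m ∈ LinearMap.range i.hom ↔ d.hom m = 0 := by rw [hex, LinearMap.mem_ker]
    simp only [LinearMap.mem_ker, LinearMap.comp_apply, LinearEquiv.coe_coe,
      LinearEquiv.symm_apply_apply, LinearMap.prodMap_apply, LinearMap.id_apply, Prod.mk_eq_zero,
      ← hm, j, LinearMap.mem_range, EmbeddingLike.apply_eq_iff_eq, LinearMap.inl_apply,
      Prod.mk.injEq]
    constructor
    · rintro ⟨x, hx, hy⟩
      exact ⟨⟨x, hx⟩, hy.symm⟩
    · rintro ⟨⟨x, hx⟩, hy⟩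
      exact ⟨x, hx, hy.symm⟩
  refine ⟨J, j, e.injective.comp (LinearMap.inl_injective.comp hi), ?_⟩
  rw [hj]
  exact isClosedFor_ker _ (h₁.isSeparatedBy.prod hY)

/-! ### Cosilting modules -/

section Cosilting

variable {C Q₀ Q₁ : ModuleCat.{u} R} {ζ : Q₀ ⟶ Q₁}

lemma IsCosiltingWith.exists_lift (h : IsCosiltingWith C ζ) {Y : Type u} [AddCommGroup Y]
    [Module R Y] {N : Submodule R Y} (hN : IsClosedFor C N) (f : Y →ₗ[R] Q₁)
    (hf : N ≤ LinearMap.ker f) :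
    ∃ g : Y →ₗ[R] Q₀, N ≤ LinearMap.ker g ∧ ζ.hom ∘ₗ g = f := by
  have hB : classB ζ (ModuleCat.of R (Y ⧸ N)) := by
    rw [← h.cogen_eq]
    exact cogen_iff.2 (isSeparatedBy_quotient_iff.2 hN)
  obtain ⟨g, hg⟩ := hB (ModuleCat.ofHom (N.liftQ f hf))
  refine ⟨g.hom ∘ₗ N.mkQ, fun n hn => ?_, LinearMap.ext fun y => ?_⟩
  · simp [(Submodule.Quotient.mk_eq_zero N).2 hn]
  · exact LinearMap.congr_fun (congrArg ModuleCat.Hom.hom hg) (N.mkQ y)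

/-- Extend `f` to a map a : Y → Q₀. Since ζ ∘ a kills `N`, it lifts to some `g` killing `N`, and a -
g lands in ker ζ = C. -/
lemma IsCosiltingWith.isExtInjectiveFor (h : IsCosiltingWith C ζ) : IsExtInjectiveFor R C C := by
  obtain ⟨hQ₀, hQ₁, i, hiζ⟩ := h.copresentation
  obtain ⟨hi, hex⟩ := isLeftExactSequence_iff.1 hiζ
  have : Module.Injective R Q₀ := Module.injective_module_of_injective_object R Q₀
  intro Y _ _ N hN f
  obtain ⟨a, ha⟩ := Module.Injective.out N.subtype N.injective_subtype (i.hom ∘ₗ f)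
  obtain ⟨g, hgN, hg⟩ := h.exists_lift hN (ζ.hom ∘ₗ a) fun n hn => by
    have h1 : a n = i.hom (f ⟨n, hn⟩) := ha ⟨n, hn⟩
    rw [LinearMap.mem_ker, LinearMap.comp_apply, h1]
    exact hex.le ⟨_, rfl⟩
  have hmem (y : Y) : (a - g) y ∈ LinearMap.range i.hom := by
    rw [hex, LinearMap.mem_ker, LinearMap.sub_apply, map_sub, sub_eq_zero]
    exact (LinearMap.congr_fun hg y).symm
  refine ⟨(LinearEquiv.ofInjective i.hom hi).symm.toLinearMap ∘ₗ (a - g).codRestrict _ hmem,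
    LinearMap.ext fun n => ?_⟩
  have h1 : a n = i.hom (f n) := ha n
  have h2 : g n = 0 := hgN n.2
  simp only [LinearMap.comp_apply, LinearEquiv.coe_coe, LinearEquiv.symm_apply_eq]
  refine Subtype.ext ?_
  change a n - g n = i.hom (f n)
  rw [h1, h2, sub_zero]

lemma IsCosiltingWith.hasClosedEmbeddings (h : IsCosiltingWith C ζ) :
    HasClosedEmbeddings R C := by
  obtain ⟨hQ₀, hQ₁, i, hiζ⟩ := h.copresentation
  obtain ⟨hi, hex⟩ := isLeftExactSequence_iff.1 hiζ
  intro X _ _ hX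
  refine ⟨_, evalPower R C X, hX.evalPower_injective, ?_⟩
  rw [← isSeparatedBy_quotient_iff]
  refine (cogen_iff (X := ModuleCat.of R (_ ⧸ LinearMap.range (evalPower R C X)))).1 ?_
  rw [h.cogen_eq]
  intro f
  have hpow : IsClosedFor C (⊥ : Submodule R ((X →ₗ[R] C) → C)) := fun y hy =>
    isSeparatedBy_power (R := R) _ y fun φ => hy φ bot_le
  obtain ⟨g, -, hg⟩ := h.exists_lift hpow
    (f.hom ∘ₗ (LinearMap.range (evalPower R C X)).mkQ) bot_le
  have hmem (x : X) : g (evalPower R C X x) ∈ LinearMap.range i.hom := by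
    rw [hex, LinearMap.mem_ker]
    refine (LinearMap.congr_fun hg _).trans ?_
    have : (LinearMap.range (evalPower R C X)).mkQ (evalPower R C X x) = 0 :=
      (Submodule.Quotient.mk_eq_zero _).2 ⟨x, rfl⟩
    rw [LinearMap.comp_apply, this, map_zero]
  -- On `X` the lift `g` lands in ker ζ = C, so it is itself a coordinate of the evaluation map;
  -- subtracting that coordinate makes `g` vanish on `X` without changing ζ ∘ g.
  let c : X →ₗ[R] C := (LinearEquiv.ofInjective i.hom hi).symm.toLinearMap ∘ₗ
    (g ∘ₗ evalPower R C X).codRestrict _ hmem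
  have hc (x : X) : i.hom (c x) = g (evalPower R C X x) :=
    congrArg Subtype.val ((LinearEquiv.ofInjective i.hom hi).apply_symm_apply
      ⟨g (evalPower R C X x), hmem x⟩)
  refine ⟨ModuleCat.ofHom ((LinearMap.range (evalPower R C X)).liftQ
    (g - i.hom ∘ₗ LinearMap.proj c) ?_), ModuleCat.hom_ext (Submodule.linearMap_qext _ ?_)⟩
  · rintro _ ⟨x, rfl⟩
    rw [LinearMap.mem_ker, LinearMap.sub_apply, sub_eq_zero]
    exact (hc x).symm
  · refine LinearMap.ext fun v => ?_
    have h1 : ζ.hom (i.hom (v c)) = 0 := hex.le ⟨_, rfl⟩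
    have h2 := LinearMap.congr_fun hg v
    change ζ.hom (g v - i.hom (v c)) = _
    rw [map_sub, h1, sub_zero]
    exact h2

end Cosilting

end Translation

end TauTilting

theorem mainTheorem9 {R : Type u} [Ring R] :
    (∀ T : ModuleCat.{u} R, TauTilting.IsQuasicotilting T →
      TauTilting.IsSupportTauMinusTilting.{u} (TauTilting.ProdClass T)) ∧
    (∀ C : ModuleCat.{u} R, TauTilting.IsCosilting C →
      TauTilting.IsSupportTauMinusTilting.{u} (TauTilting.ProdClass C)) := by
  constructor
  · intro T hT
    exact TauTilting.prodClass_isSupportTauMinusTilting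
      (TauTilting.isExtInjectiveFor_of_ext_eq_zero hT.ext_injective.2)
      (TauTilting.hasClosedEmbeddings_of_cogen_eq_copres hT.cogen_eq_copres)
  · rintro C ⟨Q₀, Q₁, ζ, h⟩
    exact TauTilting.prodClass_isSupportTauMinusTilting h.isExtInjectiveFor h.hasClosedEmbeddings
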